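/- A circuit with inputs $x_1,\dots,x_n$ is a finite directed acyclic graph of unbounded fan-in with $n$ input gates, in which every other gate (an arithmetic gate) computes the sum of the values at the tails of its incoming wires (the empty sum being $0$), and in which outputs $y_1,\dots,y_m$ are designated among the arithmetic gates; its size is its number of wires. For a boolean matrix $A\in\{0,1\}^{m\times n}$, let $C_{\mathrm{OR}}(A)$ and $C_{\mathrm{SUM}}(A)$ be the minimum size of a circuit that computes $y=Ax$ over the boolean semiring $(\{0,1\},\vee,\wedge)$ and over the semiring $(\mathbb N,+,\cdot)$ of non-negative integers, respectively. Let $$\mathrm{Gap}_{\mathrm{SUM}/\mathrm{OR}}(n)=\max_{A\in\{0,1\}^{n\times n}} \frac{C_{\mathrm{SUM}}(A)}{C_{\mathrm{OR}}(A)},$$ where the zero matrix, for which both complexities are $0$, contributes the ratio $0$. Let $\bar I_n$ be the boolean complement of the $n\times n$ identity matrix, let $\otimes$ be the Kronecker product, and let $\log$ be the logarithm to base $2$. Theorem. (i) $\mathrm{Gap}_{\mathrm{SUM}/\mathrm{OR}}(n)=\Omega(n^{1/2}/\log^2 n)$. That is, there are $c>0$ and $n_0$ such that $\mathrm{Gap}_{\mathrm{SUM}/\mathrm{OR}}(n)\ge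 c\,n^{1/2}/\log^2 n$ for all $n\ge n_0$. (ii) There are constants $K,c>0$ and $n_0$ such that for every $n\ge n_0$, with $N=n^2$, there is a matrix $A\in\{0,1\}^{n\times n}$ for which the $N\times N$ matrix $\bar I_n\otimes A$ satisfies $$C_{\mathrm{OR}}(\bar I_n\otimes A)\le K N\qquad\text{and}\qquad C_{\mathrm{SUM}}(\bar I_n\otimes A)\ge c\,\frac{N^{3/2}}{\log^2 N}.$$ -/

import Mathlib

open scoped Matrix

/-- The boolean semiring `({0, 1}, ∨, ∧)`, on the type `Bool`. -/
def BoolSemiring : Type := Bool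

namespace BoolSemiring

instance : DecidableEq BoolSemiring := inferInstanceAs (DecidableEq Bool)

instance : Fintype BoolSemiring := inferInstanceAs (Fintype Bool)

instance : Zero BoolSemiring := ⟨false⟩

instance : One BoolSemiring := ⟨true⟩

instance : Add BoolSemiring := ⟨or⟩

instance : Mul BoolSemiring := ⟨and⟩

instance : CommSemiring BoolSemiring where
  add_assoc := by decide
  zero_add := by decide
  add_zero := by decide
  add_comm := by decide
  left_distrib := by decide
  right_distrib := by decide
  zero_mul := by decide
  mul_zero := by decide
  mul_assoc := by decide
  one_mul := by decide
  mul_one := by decide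
  mul_comm := by decide
  nsmul := nsmulRec
  npow := npowRec

end BoolSemiring

/-- An unbounded fan-in circuit with input gates indexed by `κ` and outputs indexed by `ι`:
a finite directed acyclic graph whose vertices are the input gates (elements of `κ`, without
incoming wires) and the arithmetic gates (elements of `Gate`). Every output is an arithmetic
gate. An arithmetic gate without incoming wires is the empty sum. -/
structure Circuit (ι κ : Type) where
  /-- The arithmetic gates. -/
  Gate : Type
  [finGate : Fintype Gate]
  [decGate : DecidableEq Gate]
  /-- The wires, as pairs (tail, head). -/
  wires : Finset ((κ ⊕ Gate) × Gate)
  /-- There is no directed cycle. -/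
  acyclic : ∀ g : Gate,
    ¬ Relation.TransGen (fun h h' : Gate => (Sum.inr h, h') ∈ wires) g g
  /-- The arithmetic gate that is designated as the output with a given index. -/
  out : ι → Gate

namespace Circuit

variable {ι κ : Type}

instance (C : Circuit ι κ) : Fintype C.Gate := C.finGate

instance (C : Circuit ι κ) : DecidableEq C.Gate := C.decGate

/-- There is a wire from the arithmetic gate `h` to the arithmetic gate `g`. -/
def Child (C : Circuit ι κ) (h g : C.Gate) : Prop := (Sum.inr h, g) ∈ C.wires

theorem wellFounded_child (C : Circuit ι κ) : WellFounded C.Child := by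
  have : Std.Irrefl (Relation.TransGen C.Child) := ⟨C.acyclic⟩
  have : IsTrans C.Gate (Relation.TransGen C.Child) := ⟨fun _ _ _ => Relation.TransGen.trans⟩
  have h := Finite.wellFounded_of_trans_of_irrefl (Relation.TransGen C.Child)
  exact Subrelation.wf (fun hab => Relation.TransGen.single hab) h

/-- The size of a circuit is its number of wires. -/
def size (C : Circuit ι κ) : ℕ := C.wires.card

/-- The wires that enter the gate `g`. -/
def inWires (C : Circuit ι κ) (g : C.Gate) : Finset ((κ ⊕ C.Gate) × C.Gate) :=
  C.wires.filter (fun w => w.2 = g)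

theorem child_of_mem_inWires (C : Circuit ι κ) {g h : C.Gate} {w : (κ ⊕ C.Gate) × C.Gate}
    (hw : w ∈ C.inWires g) (hh : w.1 = Sum.inr h) : C.Child h g := by
  obtain ⟨w1, w2⟩ := w
  obtain ⟨h1, rfl⟩ := Finset.mem_filter.mp hw
  dsimp only at hh
  subst hh
  exact h1

/-- The value of an arithmetic gate over the semiring `R`, on the input vector `x`: the sum,
over the wires that enter the gate, of the values at the tails of these wires. -/
noncomputable def eval {R : Type*} [CommSemiring R] (C : Circuit ι κ) (x : κ → R) :
    C.Gate → R :=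
  C.wellFounded_child.fix fun g val =>
    ∑ w ∈ (C.inWires g).attach,
      match hw : w.1.1 with
      | Sum.inl j => x j
      | Sum.inr h => val h (C.child_of_mem_inWires w.2 hw)

/-- The recursion that characterises `eval`. -/
theorem eval_eq {R : Type*} [CommSemiring R] (C : Circuit ι κ) (x : κ → R) (g : C.Gate) :
    C.eval x g = ∑ w ∈ C.inWires g, Sum.elim x (C.eval x) w.1 := by
  rw [eval, WellFounded.fix_eq, ← Finset.sum_attach (C.inWires g)]
  refine Finset.sum_congr rfl fun w _ => ?_
  split <;> rename_i hw <;> simp [hw]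

/-- The circuit `C` computes `x ↦ A x` over the semiring `R`, where `A` is a boolean matrix,
that is, a matrix with entries in `{0, 1} ⊆ R`. -/
def Computes (R : Type*) [CommSemiring R] [Fintype κ] (C : Circuit ι κ)
    (A : Matrix ι κ Bool) : Prop :=
  ∀ (x : κ → R) (i : ι),
    C.eval x (C.out i) = (A.map (fun b => if b then (1 : R) else 0) *ᵥ x) i

end Circuit

/-- The complexity `C_R(A)` of the boolean matrix `A`: the minimum number of wires in an unbounded
fan-in circuit that computes `x ↦ A x` over the semiring `R`. -/
noncomputable def circuitComplexity (R : Type*) [CommSemiring R] {ι κ : Type} [Fintype κ]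
    (A : Matrix ι κ Bool) : ℕ :=
  sInf {s : ℕ | ∃ C : Circuit ι κ, C.Computes R A ∧ C.size = s}

/-- Every boolean matrix is computed by a circuit of depth one whose size is the number of
`1`-entries, so that the minimum in `circuitComplexity` is over a nonempty set. -/
theorem exists_circuit_computes (R : Type*) [CommSemiring R] {ι κ : Type} [Fintype ι]
    [DecidableEq ι] [Fintype κ] [DecidableEq κ] (A : Matrix ι κ Bool) :
    ∃ C : Circuit ι κ, C.Computes R A ∧
      C.size = (Finset.univ.filter (fun p : ι × κ => A p.1 p.2 = true)).card := by
  let W : Finset ((κ ⊕ ι) × ι) :=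
    (Finset.univ.filter (fun p : ι × κ => A p.1 p.2 = true)).image
      (fun p => (Sum.inl p.2, p.1))
  have hW : ∀ h g : ι, (Sum.inr h, g) ∉ W := by
    intro h g hm
    simp [W] at hm
  let C : Circuit ι κ :=
    { Gate := ι
      wires := W
      acyclic := by
        intro g hg
        obtain ⟨h, h1, -⟩ := Relation.TransGen.head'_iff.mp hg
        exact hW _ _ h1
      out := id }
  refine ⟨C, ?_, ?_⟩
  · intro x i
    have hin : C.inWires i = (Finset.univ.filter (fun j : κ => A i j = true)).image
        (fun j => ((Sum.inl j : κ ⊕ ι), i)) := by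
      ext ⟨a, b⟩
      simp only [Circuit.inWires, C, W, Finset.mem_filter, Finset.mem_image, Finset.mem_univ,
        true_and, Prod.exists, Prod.mk.injEq]
      constructor
      · rintro ⟨⟨i', j, hA, rfl, rfl⟩, hb⟩
        have hb' : i' = i := hb
        subst hb'
        exact ⟨j, hA, rfl, rfl⟩
      · rintro ⟨j, hA, rfl, rfl⟩
        exact ⟨⟨i, j, hA, rfl, rfl⟩, rfl⟩
    have hev := C.eval_eq x i
    rw [hin] at hev
    have hs := Finset.sum_image (s := Finset.univ.filter (fun j : κ => A i j = true))
      (g := fun j => ((Sum.inl j : κ ⊕ ι), i)) (f := fun w => Sum.elim x (C.eval x) w.1)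
      (by intro a _ b _ hab; simpa using hab)
    refine hev.trans (hs.trans ?_)
    simp [Matrix.mulVec, dotProduct, Finset.sum_filter]
  · simp only [Circuit.size, C, W]
    apply Finset.card_image_of_injective
    rintro ⟨a, b⟩ ⟨c, d⟩ h
    simp at h
    simp [h]

/-- The complexity `C_∨(A)` with respect to OR-circuits. -/
noncomputable def orComplexity {ι κ : Type} [Fintype κ] (A : Matrix ι κ Bool) : ℕ :=
  circuitComplexity BoolSemiring A

/-- The complexity `C_+(A)` with respect to SUM-circuits (addition of non-negative integers). -/
noncomputable def sumComplexity {ι κ : Type} [Fintype κ] (A : Matrix ι κ Bool) : ℕ :=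
  circuitComplexity ℕ A

/-- The maximum of `C_+(A) / C_∨(A)` over all boolean `n × n` matrices `A`. (The zero matrix, for
which both complexities are `0`, contributes the ratio `0 / 0 = 0`; it is the only one.) -/
noncomputable def gapSumOr (n : ℕ) : ℝ :=
  ⨆ A : Matrix (Fin n) (Fin n) Bool, (sumComplexity A : ℝ) / (orComplexity A : ℝ)

/-- The boolean complement of the `n × n` identity matrix. -/
def complId (n : ℕ) : Matrix (Fin n) (Fin n) Bool :=
  Matrix.of fun i j => decide (i ≠ j)

/-- The Kronecker product of boolean matrices. -/
def boolKronecker {ι κ ι' κ' : Type} (B : Matrix ι κ Bool) (A : Matrix ι' κ' Bool) :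
    Matrix (ι × ι') (κ × κ') Bool :=
  Matrix.kroneckerMap and B A

/-! The matrix `Ī_n ⊗ A` separates the two models because OR tolerates overlapping unions and SUM
does not.

OR bound, for every `A`: embed the `n` indices into `2 ^ r` and split these as `Bool × W`. The
indices other than `(c, w)` are covered by all `(c', w')` with `w' ≠ w` and all `(!c, w')`; the
overlap is harmless. The first family is the same problem over `W` with the two halves merged, the
second needs one product with `A` per value of `c` (`complKroneckerCost_double`). So about `log n`
levels use two products with `A` each, and a product costs `O(n² / log n)` wires by tabulating the
unions of short blocks of columns (`mulBlocks`). The remaining wires form a geometric sum, and the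
total is `O(n²)`.

SUM bound, for `A` without a `k × k` submatrix of ones: call a vertex small if it depends on fewer
than `k` columns of `A`, and cut the circuit at the wires from small to non-small vertices
(`exists_cut`). For each one `(r, s)` of `A` in a row with at least `k` ones, the matrix `Ī_n`
factors through the wires relevant to `(r, s)`, so there are at least `rank Ī_n = n` of them. As
nothing cancels over `ℕ`, one wire is relevant to at most `k²` pairs (`rank_mul_card_le_size_mul`).
Counting yields such an `A` with at least `n² / 2` ones and `k = O(log n)`, so at least of order `n³
/ log² n` wires are needed. Padding with zeros gives the gap in every large dimension. -/

namespace BoolSemiring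

theorem eq_iff {a b : BoolSemiring} : a = b ↔ (a = 1 ↔ b = 1) := by
  revert a b; decide

theorem add_eq_one_iff {a b : BoolSemiring} : a + b = 1 ↔ a = 1 ∨ b = 1 := by
  revert a b; decide

theorem mul_eq_one_iff {a b : BoolSemiring} : a * b = 1 ↔ a = 1 ∧ b = 1 := by
  revert a b; decide

theorem zero_ne_one : (0 : BoolSemiring) ≠ 1 := by decide

theorem sum_eq_one_iff {α : Type*} (s : Finset α) (f : α → BoolSemiring) :
    ∑ a ∈ s, f a = 1 ↔ ∃ a ∈ s, f a = 1 := by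
  classical
  induction s using Finset.induction_on with
  | empty => simp [zero_ne_one]
  | insert a s ha ih => simp [Finset.sum_insert ha, add_eq_one_iff, ih]

end BoolSemiring

/-! ### OR-circuits as reachability. -/

namespace Circuit

variable {ι κ : Type}

/-- There is a directed path from the input gate `j` to the arithmetic gate. -/
inductive Feeds (C : Circuit ι κ) (j : κ) : C.Gate → Prop
  | input {g : C.Gate} : (Sum.inl j, g) ∈ C.wires → Feeds C j g
  | gate {h g : C.Gate} : (Sum.inr h, g) ∈ C.wires → Feeds C j h → Feeds C j g

/-- The set of inputs from which a vertex of the circuit can be reached. -/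
def support (C : Circuit ι κ) : κ ⊕ C.Gate → Set κ :=
  Sum.elim (fun j => {j}) (fun g => {j | C.Feeds j g})

/-- Multiplicities of paths are invisible to OR, so from here on OR-circuits are handled through the
sets of inputs that reach each vertex. -/
theorem eval_boolSemiring_eq_one_iff (C : Circuit ι κ) (x : κ → BoolSemiring) (g : C.Gate) :
    C.eval x g = 1 ↔ ∃ j, C.Feeds j g ∧ x j = 1 := by
  induction g using C.wellFounded_child.induction with
  | _ g ih =>
    rw [eval_eq, BoolSemiring.sum_eq_one_iff]
    constructor
    · rintro ⟨⟨v, g'⟩, hw, hv⟩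
      obtain ⟨hw', hg : g' = g⟩ := Finset.mem_filter.mp hw
      subst hg
      cases v with
      | inl j => exact ⟨j, .input hw', hv⟩
      | inr h =>
        obtain ⟨j, hj, hx⟩ := (ih h hw').mp hv
        exact ⟨j, .gate hw' hj, hx⟩
    · rintro ⟨j, hj, hx⟩
      cases hj with
      | input hw => exact ⟨_, Finset.mem_filter.mpr ⟨hw, rfl⟩, hx⟩
      | @gate h _ hw hj =>
        exact ⟨_, Finset.mem_filter.mpr ⟨hw, rfl⟩, (ih h hw).mpr ⟨j, hj, hx⟩⟩

theorem computes_boolSemiring_of_feeds_iff [Fintype κ] (C : Circuit ι κ) (A : Matrix ι κ Bool)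
    (h : ∀ i j, C.Feeds j (C.out i) ↔ A i j = true) : C.Computes BoolSemiring A := by
  intro x i
  rw [BoolSemiring.eq_iff, eval_boolSemiring_eq_one_iff]
  simp only [Matrix.mulVec, dotProduct, BoolSemiring.sum_eq_one_iff, Matrix.map_apply,
    BoolSemiring.mul_eq_one_iff, Finset.mem_univ, true_and, h]
  refine exists_congr fun j => and_congr_left fun _ => ?_
  cases A i j
  · simp [BoolSemiring.zero_ne_one]
  · simp

section layer

variable {ι' : Type} [Fintype ι'] [DecidableEq ι'] [DecidableEq κ]

/-- The wires of the circuit that arises from `C` by adding a layer of new gates. -/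
def layerWires (C : Circuit ι κ) (T : ι' → Finset (κ ⊕ C.Gate)) :
    Finset ((κ ⊕ (C.Gate ⊕ ι')) × (C.Gate ⊕ ι')) :=
  C.wires.image (Prod.map (Sum.map id Sum.inl) Sum.inl) ∪
    Finset.univ.biUnion fun i => (T i).image fun v => (Sum.map id Sum.inl v, Sum.inr i)

theorem mem_layerWires_inl (C : Circuit ι κ) (T : ι' → Finset (κ ⊕ C.Gate))
    (v : κ ⊕ (C.Gate ⊕ ι')) (g : C.Gate) :
    (v, Sum.inl g) ∈ C.layerWires T ↔ ∃ u, (u, g) ∈ C.wires ∧ Sum.map id Sum.inl u = v := by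
  simp [layerWires]

theorem mem_layerWires_inr (C : Circuit ι κ) (T : ι' → Finset (κ ⊕ C.Gate))
    (v : κ ⊕ (C.Gate ⊕ ι')) (i : ι') :
    (v, Sum.inr i) ∈ C.layerWires T ↔ ∃ u ∈ T i, Sum.map id Sum.inl u = v := by
  simp only [layerWires, Finset.mem_union, Finset.mem_image, Finset.mem_biUnion, Prod.map_apply,
    Prod.mk.injEq, Finset.mem_univ, true_and, Prod.exists, reduceCtorEq, and_false, exists_false,
    false_or, Sum.inr.injEq]
  constructor
  · rintro ⟨i', u, hu, he, rfl⟩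
    exact ⟨u, hu, he⟩
  · rintro ⟨u, hu, he⟩
    exact ⟨i, u, hu, he, rfl⟩

theorem card_layerWires_le (C : Circuit ι κ) (T : ι' → Finset (κ ⊕ C.Gate)) :
    (C.layerWires T).card ≤ C.size + ∑ i, (T i).card := by
  refine (Finset.card_union_le _ _).trans (Nat.add_le_add Finset.card_image_le ?_)
  exact Finset.card_biUnion_le.trans (Finset.sum_le_sum fun i _ => Finset.card_image_le)

/-- The circuit that arises from `C` by adding a layer of new gates, which become the outputs. -/
def layer (C : Circuit ι κ) (T : ι' → Finset (κ ⊕ C.Gate)) : Circuit ι' κ where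
  Gate := C.Gate ⊕ ι'
  wires := C.layerWires T
  acyclic := by
    -- All old gates precede all new ones, and no wire joins two new gates.
    have hwf := Sum.lex_wf C.wellFounded_child
      (emptyWf.wf : WellFounded (emptyRelation : ι' → ι' → Prop))
    have hsub : WellFounded fun h h' : C.Gate ⊕ ι' => (Sum.inr h, h') ∈ C.layerWires T := by
      refine Subrelation.wf (fun {a b} hab => ?_) hwf
      cases b with
      | inl b =>
        obtain ⟨u, hu, he⟩ := (C.mem_layerWires_inl T _ _).mp hab
        cases u with
        | inl j => simp at he
        | inr g =>
          obtain rfl : Sum.inl g = a := by simpa using he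
          exact Sum.Lex.inl hu
      | inr b =>
        obtain ⟨u, hu, he⟩ := (C.mem_layerWires_inr T _ _).mp hab
        cases u with
        | inl j => simp at he
        | inr g =>
          obtain rfl : Sum.inl g = a := by simpa using he
          exact Sum.Lex.sep _ _
    exact fun g hg => hsub.transGen.irrefl.irrefl g hg
  out := Sum.inr

/-- New gates have no outgoing wires, so they cannot affect what reaches an old gate. -/
theorem feeds_layer_inl (C : Circuit ι κ) (T : ι' → Finset (κ ⊕ C.Gate)) (j : κ) (g : C.Gate) :
    (C.layer T).Feeds j (Sum.inl g) ↔ C.Feeds j g := by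
  constructor
  · suffices h : ∀ g' : (C.layer T).Gate, (C.layer T).Feeds j g' →
        ∀ g, g' = Sum.inl g → C.Feeds j g from fun hg => h _ hg g rfl
    intro g' h
    induction h with
    | input hw =>
      rintro g rfl
      obtain ⟨u, hu, he⟩ := (C.mem_layerWires_inl T _ _).mp hw
      cases u with
      | inl j' =>
        obtain rfl : j' = j := Sum.inl_injective he
        exact .input hu
      | inr g => simp at he
    | gate hw _ ih =>
      rintro g rfl
      obtain ⟨u, hu, he⟩ := (C.mem_layerWires_inl T _ _).mp hw
      cases u with
      | inl j' => simp at he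
      | inr h => exact .gate hu (ih h (Sum.inr_injective he).symm)
  · intro h
    induction h with
    | input hw => exact .input ((C.mem_layerWires_inl T _ _).mpr ⟨_, hw, rfl⟩)
    | gate hw _ ih => exact .gate ((C.mem_layerWires_inl T _ _).mpr ⟨_, hw, rfl⟩) ih

theorem support_layer_old (C : Circuit ι κ) (T : ι' → Finset (κ ⊕ C.Gate)) (v : κ ⊕ C.Gate) :
    (C.layer T).support (Sum.map id Sum.inl v) = C.support v := by
  cases v with
  | inl j => rfl
  | inr g => exact Set.ext fun j => C.feeds_layer_inl T j g

theorem feeds_layer_out (C : Circuit ι κ) (T : ι' → Finset (κ ⊕ C.Gate)) (j : κ) (i : ι') :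
    (C.layer T).Feeds j ((C.layer T).out i) ↔ ∃ v ∈ T i, j ∈ C.support v := by
  constructor
  · intro h
    generalize hg : (C.layer T).out i = g at h
    cases h with
    | input hw =>
      subst hg
      obtain ⟨u, hu, he⟩ := (C.mem_layerWires_inr T _ _).mp hw
      cases u with
      | inl j' =>
        obtain rfl : j' = j := Sum.inl_injective he
        exact ⟨_, hu, rfl⟩
      | inr g => simp at he
    | @gate h₁ _ hw hf =>
      subst hg
      obtain ⟨u, hu, he⟩ := (C.mem_layerWires_inr T _ _).mp hw
      cases u with
      | inl j' => simp at he
      | inr h =>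
        obtain rfl : Sum.inl h = h₁ := Sum.inr_injective he
        exact ⟨_, hu, (C.feeds_layer_inl T j h).mp hf⟩
  · rintro ⟨v, hv, hj⟩
    have hw : (Sum.map id Sum.inl v, (Sum.inr i : C.Gate ⊕ ι')) ∈ C.layerWires T :=
      (C.mem_layerWires_inr T _ _).mpr ⟨v, hv, rfl⟩
    cases v with
    | inl j' =>
      obtain rfl : j = j' := hj
      exact .input hw
    | inr g => exact .gate hw ((C.feeds_layer_inl T j g).mpr hj)

end layer

end Circuit

/-! ### Calculus of derivable sets: building OR-circuits by successive unions. -/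

/-- Some circuit with at most `s` wires has, for each set in `P`, a vertex which is reached
from precisely the inputs in that set. -/
def OrDerivable {κ : Type} (s : ℕ) (P : Set (Set κ)) : Prop :=
  ∃ (ι : Type) (C : Circuit ι κ), C.size ≤ s ∧ ∀ S ∈ P, ∃ v, C.support v = S

namespace OrDerivable

variable {κ : Type}

theorem mono {s t : ℕ} {P : Set (Set κ)} (h : OrDerivable s P) (hst : s ≤ t) :
    OrDerivable t P := by
  obtain ⟨ι, C, hC, hP⟩ := h
  exact ⟨ι, C, hC.trans hst, hP⟩

theorem singletons : OrDerivable 0 (Set.range fun j : κ => ({j} : Set κ)) := by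
  refine ⟨Empty, ⟨Empty, ∅, fun g => g.elim, id⟩, le_rfl, ?_⟩
  rintro _ ⟨j, rfl⟩
  exact ⟨Sum.inl j, rfl⟩

/-- New sets can be derived as unions of derived sets, each at a cost which bounds the number
of sets in the union. -/
theorem iUnion {s : ℕ} {P : Set (Set κ)} (h : OrDerivable s P) {α ι : Type} [Finite ι]
    (y : α → Set κ) (hy : ∀ a, y a ∈ P) (J : ι → Finset α) (d : ℕ)
    (hJ : ∀ i, (J i).card ≤ d) :
    ∃ Q, P ⊆ Q ∧ OrDerivable (s + Nat.card ι * d) Q ∧ ∀ i, (⋃ a ∈ J i, y a) ∈ Q := by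
  classical
  have := Fintype.ofFinite ι
  obtain ⟨ι₀, C, hC, hP⟩ := h
  choose v hv using fun a => hP (y a) (hy a)
  refine ⟨P ∪ Set.range fun i => ⋃ a ∈ J i, y a, Set.subset_union_left,
    ⟨ι, C.layer fun i => (J i).image v, ?_, ?_⟩, fun i => Or.inr ⟨i, rfl⟩⟩
  · refine (C.card_layerWires_le _).trans (Nat.add_le_add hC ?_)
    refine (Finset.sum_le_card_nsmul _ _ d fun i _ => Finset.card_image_le.trans (hJ i)).trans ?_
    simp
  · rintro S (hS | ⟨i, rfl⟩)
    · obtain ⟨u, hu⟩ := hP S hS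
      exact ⟨_, (C.support_layer_old _ u).trans hu⟩
    · refine ⟨Sum.inr ((C.layer fun i => (J i).image v).out i), Set.ext fun j => ?_⟩
      refine (C.feeds_layer_out _ j i).trans ?_
      simp [hv]

/-- Outputs must be arithmetic gates, whereas a derived set may sit at an input; one extra gate and
wire per row repairs this. -/
theorem orComplexity_le [Fintype κ] {ι : Type} [Fintype ι] {s : ℕ} {P : Set (Set κ)}
    (h : OrDerivable s P) (M : Matrix ι κ Bool) (hM : ∀ i, {j | M i j = true} ∈ P) :
    orComplexity M ≤ s + Fintype.card ι := by
  classical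
  obtain ⟨ι₀, C, hC, hP⟩ := h
  choose v hv using fun i => hP _ (hM i)
  have hcomp : (C.layer fun i => {v i}).Computes BoolSemiring M := by
    refine Circuit.computes_boolSemiring_of_feeds_iff _ _ fun i j => ?_
    rw [Circuit.feeds_layer_out]
    simp [hv]
  have hle : orComplexity M ≤ (C.layer fun i => {v i}).size := Nat.sInf_le ⟨_, hcomp, rfl⟩
  refine hle.trans ((C.card_layerWires_le _).trans ?_)
  simpa using hC

/-- Multiplication by a boolean matrix whose columns are divided into blocks, where all the
unions of each block are derived first. -/
theorem mulBlocks {R V β : Type} [Fintype R] [Fintype V] [Fintype β] (A : Matrix R V Bool)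
    (b : V → β) (σ : ℕ) (hσ : ∀ c, Nat.card {v // b v = c} ≤ σ) {s : ℕ} {P : Set (Set κ)}
    (h : OrDerivable s P) (z : V → Set κ) (hz : ∀ v, z v ∈ P) :
    ∃ Q, P ⊆ Q ∧
      OrDerivable (s + (Fintype.card β * 2 ^ σ * σ + Fintype.card R * Fintype.card β)) Q ∧
      ∀ i, {x | ∃ v, A i v = true ∧ x ∈ z v} ∈ Q := by
  classical
  have hcard : ∀ c (X : Finset {v // b v = c}), X.card ≤ σ := fun c X =>
    (Finset.card_le_univ X).trans (by rw [← Nat.card_eq_fintype_card]; exact hσ c)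
  -- Tabulate the unions over all subsets of all blocks; afterwards each row takes one table entry
  -- per block.
  obtain ⟨P₁, hP₁, h₁, hm₁⟩ := h.iUnion z hz
    (fun X : Σ c, Finset {v // b v = c} => X.2.map (Function.Embedding.subtype _))
    σ (fun X => by rw [Finset.card_map]; exact hcard _ _)
  obtain ⟨Q, hQ, h₂, hm₂⟩ := h₁.iUnion _ hm₁
    (fun i : R => Finset.univ.image fun c : β =>
      (⟨c, Finset.univ.filter fun v => A i v = true⟩ : Σ c, Finset {v // b v = c}))
    (Fintype.card β) (fun i => Finset.card_image_le)
  refine ⟨Q, hP₁.trans hQ, h₂.mono ?_, fun i => ?_⟩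
  · rw [← add_assoc, Nat.card_eq_fintype_card (α := R)]
    refine Nat.add_le_add_right (Nat.add_le_add_left (Nat.mul_le_mul_right _ ?_) _) _
    rw [Nat.card_sigma]
    refine (Finset.sum_le_card_nsmul _ _ (2 ^ σ) fun c _ => ?_).trans (by simp)
    rw [Nat.card_eq_fintype_card, Fintype.card_finset, ← Nat.card_eq_fintype_card]
    exact Nat.pow_le_pow_right (by norm_num) (hσ c)
  convert hm₂ i using 1
  ext x
  simp

/-- The cost `B` suffices to multiply by `Ī_W ⊗ A`. -/
def ComplKroneckerCost (κ W : Type) {R V : Type} (A : Matrix R V Bool) (B : ℕ) : Prop :=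
  ∀ (s : ℕ) (P : Set (Set κ)) (y : W → V → Set κ), OrDerivable s P → (∀ w v, y w v ∈ P) →
    ∃ Q, P ⊆ Q ∧ OrDerivable (s + B) Q ∧
      ∀ w i, {x | ∃ w' v, w' ≠ w ∧ A i v = true ∧ x ∈ y w' v} ∈ Q

/-- Idempotence of OR enters here: the indices other than `(c, w)` are covered by the overlapping
families `w' ≠ w` and `c' = !c`. Merging the two halves costs `2|W||V|` wires, the union over each
half `2|W||V|` in all, and the final joins `4|W||V|`. -/
theorem complKroneckerCost_double {W V : Type} [Fintype W] [Fintype V] (A : Matrix V V Bool)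
    {a B : ℕ}
    (ha : ∀ (s : ℕ) (P : Set (Set κ)) (z : V → Set κ), OrDerivable s P → (∀ v, z v ∈ P) →
      ∃ Q, P ⊆ Q ∧ OrDerivable (s + a) Q ∧ ∀ i, {x | ∃ v, A i v = true ∧ x ∈ z v} ∈ Q)
    (hB : ComplKroneckerCost κ W A B) :
    ComplKroneckerCost κ (Bool × W) A (B + 8 * (Fintype.card W * Fintype.card V) + 2 * a) := by
  classical
  intro s P y hP hy
  obtain ⟨P₁, hs₁, h₁, hm₁⟩ := hP.iUnion (fun p : (Bool × W) × V => y p.1 p.2) (fun p => hy _ _)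
    (fun q : W × V => Finset.univ.image fun c : Bool => ((c, q.1), q.2))
    2 (fun i => Finset.card_image_le)
  obtain ⟨P₂, hs₂, h₂, hm₂⟩ := h₁.iUnion (fun p : (Bool × W) × V => y p.1 p.2)
    (fun p => hs₁ (hy _ _))
    (fun q : Bool × V => Finset.univ.image fun w : W => ((q.1, w), q.2))
    (Fintype.card W) (fun i => Finset.card_image_le)
  obtain ⟨P₃, hs₃, h₃, hm₃⟩ := hB _ _ _ h₂ (fun w v => hs₂ (hm₁ (w, v)))
  obtain ⟨P₄, hs₄, h₄, hm₄⟩ := ha _ _ _ h₃ (fun v => hs₃ (hm₂ (true, v)))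
  obtain ⟨P₅, hs₅, h₅, hm₅⟩ := ha _ _ _ h₄ (fun v => hs₄ (hs₃ (hm₂ (false, v))))
  obtain ⟨Q, hQ, h₆, hm₆⟩ := h₅.iUnion
    (Sum.elim (fun p : W × V => {x | ∃ w' v, w' ≠ p.1 ∧ A p.2 v = true ∧
        x ∈ ⋃ a ∈ Finset.univ.image fun c : Bool => ((c, w'), v), y a.1 a.2})
      (fun p : Bool × V => {x | ∃ v, A p.2 v = true ∧
        x ∈ ⋃ a ∈ Finset.univ.image fun w : W => ((p.1, w), v), y a.1 a.2}))
    (by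
      rintro (⟨w, i⟩ | ⟨_ | _, i⟩)
      · exact hs₅ (hs₄ (hm₃ w i))
      · exact hm₅ i
      · exact hs₅ (hm₄ i))
    (fun q : (Bool × W) × V => {Sum.inl (q.1.2, q.2), Sum.inr (!q.1.1, q.2)})
    2 (fun i => Finset.card_le_two)
  refine ⟨Q, hs₁.trans (hs₂.trans (hs₃.trans (hs₄.trans (hs₅.trans hQ)))),
    h₆.mono (le_of_eq ?_), ?_⟩
  · rw [Nat.card_prod, Nat.card_prod, Nat.card_prod, Nat.card_prod]
    simp only [Nat.card_eq_fintype_card, Fintype.card_bool]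
    ring
  rintro ⟨c, w⟩ i
  convert hm₆ ((c, w), i) using 1
  ext x
  simp only [Finset.mem_insert, Finset.mem_singleton, Set.iUnion_iUnion_eq_or_left,
    Set.iUnion_iUnion_eq_left, Sum.elim_inl, Sum.elim_inr, Set.mem_union, Set.mem_ofPred_eq,
    Set.mem_iUnion, Finset.mem_image, Finset.mem_univ, true_and, exists_prop]
  constructor
  · rintro ⟨⟨c', w'⟩, v, hne, hA, hx⟩
    -- If `w' = w` then `c'` must differ from `c`, so the second family applies; otherwise the first
    -- does.
    by_cases hw : w' = w
    · subst hw
      have hc : c' = !c := by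
        cases c <;> cases c' <;> simp_all
      subst hc
      exact Or.inr ⟨v, hA, _, ⟨w', rfl⟩, hx⟩
    · exact Or.inl ⟨w', v, hw, hA, _, ⟨c', rfl⟩, hx⟩
  · rintro (⟨w', v, hw, hA, _, ⟨c', rfl⟩, hx⟩ | ⟨v, hA, _, ⟨w', rfl⟩, hx⟩)
    · exact ⟨(c', w'), v, fun h => hw (congrArg Prod.snd h), hA, hx⟩
    · exact ⟨(!c, w'), v, fun h => by simpa using congrArg Prod.fst h, hA, hx⟩

theorem exists_complKroneckerCost {V : Type} [Fintype V] (A : Matrix V V Bool) {a : ℕ}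
    (ha : ∀ (s : ℕ) (P : Set (Set κ)) (z : V → Set κ), OrDerivable s P → (∀ v, z v ∈ P) →
      ∃ Q, P ⊆ Q ∧ OrDerivable (s + a) Q ∧ ∀ i, {x | ∃ v, A i v = true ∧ x ∈ z v} ∈ Q)
    (r : ℕ) :
    ∃ (W : Type) (_ : Fintype W), Fintype.card W = 2 ^ r ∧
      ComplKroneckerCost κ W A (8 * (2 ^ r * Fintype.card V) + 2 * (r * a)) := by
  induction r with
  | zero =>
    -- With one index there is no `w' ≠ w`: only the empty union is needed, and it costs no wires.
    refine ⟨Unit, inferInstance, rfl, fun s P y hP hy => ?_⟩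
    obtain ⟨Q, hs, hQ, hm⟩ := hP.iUnion (ι := Unit) (fun p : Unit × V => y p.1 p.2)
      (fun p => hy _ _) (fun _ => ∅) 0 (by simp)
    refine ⟨Q, hs, hQ.mono (by omega), fun w i => ?_⟩
    convert hm () using 1
    ext x
    simp
  | succ r ih =>
    obtain ⟨W, _, hW, hB⟩ := ih
    refine ⟨Bool × W, inferInstance, by simp [hW, pow_succ, mul_comm], ?_⟩
    convert complKroneckerCost_double A ha hB using 1
    rw [hW]
    ring

end OrDerivable

/-- A matrix whose nonzero part is `Ī_n ⊗ A` has OR-complexity linear in the number of its rows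
and of the rows of `Ī_n ⊗ A`. -/
theorem orComplexity_complId_kronecker_le {n : ℕ} (hn : 4 ≤ n) (A : Matrix (Fin n) (Fin n) Bool)
    {ι κ : Type} [Fintype ι] [Fintype κ] (M : Matrix ι κ Bool) (g : Fin n × Fin n → κ)
    (hM : ∀ i, {j | M i j = true} = ∅ ∨ ∃ p, {j | M i j = true} =
      g '' {q | boolKronecker (complId n) A p q = true}) :
    orComplexity M ≤ 48 * n ^ 2 + Fintype.card ι := by
  classical
  -- Blocks of half the logarithm keep a table of size `σ * 2 ^ σ ≤ n` per block, while `r ≤ 4 * σ`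
  -- lets the saving in each product with `A` pay for all `r` levels.
  set σ := Nat.log 2 n / 2 with hσ
  set r := Nat.log 2 n + 1 with hr
  have hlog : 2 ≤ Nat.log 2 n := Nat.le_log_of_pow_le (by norm_num) (by simpa using hn)
  have hσ1 : 1 ≤ σ := by omega
  have hrσ : r ≤ 4 * σ := by omega
  have hnr : n < 2 ^ r := Nat.lt_pow_succ_log_self (by norm_num) n
  have hrn : 2 ^ r ≤ 2 * n := by
    rw [hr, pow_succ, mul_comm]
    exact Nat.mul_le_mul_left _ (Nat.pow_log_le_self 2 (by omega))
  have h2σ : σ * 2 ^ σ ≤ n := calc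
    σ * 2 ^ σ ≤ 2 ^ σ * 2 ^ σ := Nat.mul_le_mul_right _ Nat.lt_two_pow_self.le
    _ = 2 ^ (σ + σ) := (pow_add 2 σ σ).symm
    _ ≤ 2 ^ Nat.log 2 n := Nat.pow_le_pow_right (by norm_num) (by omega)
    _ ≤ n := Nat.pow_log_le_self 2 (by omega)
  have hσn : σ ≤ n := (Nat.le_mul_of_pos_right _ (by positivity)).trans h2σ
  have hblock : ∀ c : Fin (n / σ + 1), Nat.card {v : Fin n //
      (⟨v / σ, Nat.lt_succ_of_le (Nat.div_le_div_right v.2.le)⟩ : Fin (n / σ + 1)) = c} ≤ σ := by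
    intro c
    have hinj : Function.Injective (fun v : {v : Fin n //
        (⟨v / σ, Nat.lt_succ_of_le (Nat.div_le_div_right v.2.le)⟩ : Fin (n / σ + 1)) = c} =>
        (⟨v.1 % σ, Nat.mod_lt _ hσ1⟩ : Fin σ)) := by
      rintro ⟨v, hv⟩ ⟨w, hw⟩ h
      have h1 : (v : ℕ) / σ = w / σ := congrArg Fin.val (hv.trans hw.symm)
      have h2 : (v : ℕ) % σ = w % σ := congrArg Fin.val h
      have h3 : (v : ℕ) = w := by rw [← Nat.div_add_mod v σ, h1, h2, Nat.div_add_mod]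
      exact Subtype.ext (Fin.ext h3)
    simpa using Nat.card_le_card_of_injective _ hinj
  obtain ⟨W, _, hW, hcost⟩ := OrDerivable.exists_complKroneckerCost (κ := κ) A
    (fun s P z h hz => OrDerivable.mulBlocks A _ σ hblock h z hz) r
  obtain ⟨e⟩ : Nonempty (Fin n ↪ W) := Function.Embedding.nonempty_of_card_le (by
    rw [hW, Fintype.card_fin]; exact hnr.le)
  -- The empty set serves the indices of `W` outside the range of `e`, and the zero rows of `M`.
  obtain ⟨P, hP, h, hm⟩ := (OrDerivable.singletons (κ := κ)).iUnion (ι := Unit) (α := κ)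
    (fun j => {j}) (fun j => ⟨j, rfl⟩) (fun _ => ∅) 0 (by simp)
  have hempty : (∅ : Set κ) ∈ P := by simpa using hm ()
  obtain ⟨Q, hPQ, hQ, hmQ⟩ := hcost _ P
    (fun w v => if hw : ∃ j, e j = w then {g (hw.choose, v)} else ∅) h (by
      intro w v
      split_ifs
      · exact hP ⟨_, rfl⟩
      · exact hempty)
  have hy : ∀ w v x, (x ∈ if hw : ∃ j, e j = w then ({g (hw.choose, v)} : Set κ) else ∅) ↔
      ∃ j, e j = w ∧ x = g (j, v) := by
    intro w v x
    split_ifs with hw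
    · constructor
      · intro hx
        exact ⟨_, hw.choose_spec, hx⟩
      · rintro ⟨j, hj, rfl⟩
        rw [e.injective (hj.trans hw.choose_spec.symm)]
        rfl
    · simp only [Set.mem_empty_iff_false, false_iff]
      rintro ⟨j, hj, -⟩
      exact hw ⟨j, hj⟩
  refine (hQ.orComplexity_le M fun i => ?_).trans (Nat.add_le_add_right ?_ _)
  · obtain hi | ⟨⟨i₁, i₂⟩, hi⟩ := hM i
    · rw [hi]; exact hPQ hempty
    · rw [hi]
      convert hmQ (e i₁) i₂ using 1
      ext x
      simp only [hy]
      constructor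
      · rintro ⟨⟨j, v⟩, hq, rfl⟩
        obtain ⟨h1, h2⟩ : i₁ ≠ j ∧ A i₂ v = true := by
          simpa [boolKronecker, complId] using hq
        exact ⟨e j, v, fun hj => h1 (e.injective hj).symm, h2, j, rfl, rfl⟩
      · rintro ⟨_, v, h1, h2, j, rfl, rfl⟩
        refine ⟨(j, v), ?_, rfl⟩
        have h3 : i₁ ≠ j := fun hj => h1 (by rw [hj])
        simp [boolKronecker, complId, h2, h3]
  · simp only [Fintype.card_fin]
    have hd : σ * (n / σ) ≤ n := Nat.mul_div_le n σ
    have h1 : (n / σ + 1) * 2 ^ σ * σ + n * (n / σ + 1) = (n / σ + 1) * (σ * 2 ^ σ + n) := by ring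
    -- Doubled, this gives `32 * n ^ 2`; the term `8 * (2 ^ r * n)` adds at most `16 * n ^ 2`, hence
    -- 48.
    have h2 : r * ((n / σ + 1) * 2 ^ σ * σ + n * (n / σ + 1)) ≤ 16 * n ^ 2 := by
      rw [h1]
      calc r * ((n / σ + 1) * (σ * 2 ^ σ + n))
          ≤ 4 * σ * ((n / σ + 1) * (n + n)) := by gcongr
        _ = 8 * n * (σ * (n / σ) + σ) := by ring
        _ ≤ 8 * n * (n + n) := by gcongr
        _ = 16 * n ^ 2 := by ring
    have h3 : 2 ^ r * n ≤ 2 * n ^ 2 := by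
      rw [pow_two, ← mul_assoc]; exact Nat.mul_le_mul_right _ hrn
    omega

/-! ### SUM lower bound: cuts and rank. -/

namespace Circuit

variable {ι κ : Type}

/-- If all the inputs satisfy `small` but a gate does not, then each path to that gate uses
precisely one last wire from a small vertex to a vertex that is not small: the value of
the gate is a combination of the values at the tails of such wires. -/
theorem exists_cut (C : Circuit ι κ) (small : κ ⊕ C.Gate → Prop) (hin : ∀ j, small (Sum.inl j))
    (g : C.Gate) (hg : ¬ small (Sum.inr g)) :
    ∃ c : (κ ⊕ C.Gate) × C.Gate → ℕ,
      (∀ e, c e ≠ 0 → small e.1 ∧ ¬ small (Sum.inr e.2) ∧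
        ∀ x : κ → ℕ, C.eval x e.2 ≤ C.eval x g) ∧
      ∀ x : κ → ℕ, C.eval x g = ∑ e ∈ C.wires, c e * Sum.elim x (C.eval x) e.1 := by
  classical
  induction g using C.wellFounded_child.induction with
  | _ g ih =>
    -- A wire with a small tail is itself in the cut; otherwise the cut of its tail is used, whose
    -- value is at most that of `g` since nothing cancels. Thus `c e` counts the paths to `g` that
    -- start with `e` and then avoid small vertices.
    have key : ∀ w ∈ C.inWires g, ∃ d : (κ ⊕ C.Gate) × C.Gate → ℕ,
        (∀ e, d e ≠ 0 → small e.1 ∧ ¬ small (Sum.inr e.2) ∧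
          ∀ x : κ → ℕ, C.eval x e.2 ≤ C.eval x g) ∧
        ∀ x : κ → ℕ, Sum.elim x (C.eval x) w.1 =
          ∑ e ∈ C.wires, d e * Sum.elim x (C.eval x) e.1 := by
      intro w hw
      obtain ⟨hmem, hwg⟩ := Finset.mem_filter.mp hw
      by_cases hs : small w.1
      · refine ⟨Pi.single w 1, fun e he => ?_, fun x => ?_⟩
        · obtain rfl : e = w := by
            by_contra hne
            exact he (Pi.single_eq_of_ne hne _)
          rw [hwg]
          exact ⟨hs, hg, fun _ => le_rfl⟩
        · rw [Finset.sum_eq_single_of_mem w hmem fun e _ he => by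
            rw [Pi.single_eq_of_ne he, zero_mul]]
          rw [Pi.single_eq_same, one_mul]
      · obtain ⟨v, g'⟩ := w
        cases v with
        | inl j => exact absurd (hin j) hs
        | inr h =>
          obtain ⟨c, hc, hsum⟩ := ih h (C.child_of_mem_inWires hw rfl) hs
          refine ⟨c, fun e he => ⟨(hc e he).1, (hc e he).2.1, fun x => ?_⟩, hsum⟩
          refine ((hc e he).2.2 x).trans ?_
          rw [C.eval_eq x g]
          exact Finset.single_le_sum (f := fun w => Sum.elim x (C.eval x) w.1)
            (fun _ _ => Nat.zero_le _) hw
    choose! d hd hsum using key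
    refine ⟨fun e => ∑ w ∈ C.inWires g, d w e, fun e he => ?_, fun x => ?_⟩
    · obtain ⟨w, hw, hne⟩ := Finset.exists_ne_zero_of_sum_ne_zero he
      exact hd w hw e hne
    · rw [C.eval_eq x g, Finset.sum_congr rfl fun w hw => hsum w hw x, Finset.sum_comm]
      exact Finset.sum_congr rfl fun e _ => (Finset.sum_mul _ _ _).symm

end Circuit

/-- A circuit over `ℕ` for a matrix that contains `B ⊗ A`, where `A` has no `k × k` submatrix of
ones, has at least `rank B · |A| / k²` wires, where `|A|` counts the ones in the rows of `A` with
at least `k` ones. -/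
theorem rank_mul_card_le_size_mul {I J R S ι κ : Type} [Fintype I] [Fintype J] [DecidableEq J]
    [Fintype R] [Fintype S] [Fintype κ] (B : Matrix I J Bool) (A : Matrix R S Bool)
    (M : Matrix ι κ Bool) (f : I × R → ι) (g : J × S → κ) (hg : Function.Injective g)
    (hM : ∀ p q, M (f p) (g q) = boolKronecker B A p q) (hB : ∀ i, ∃ j, B i j = true)
    (k : ℕ) (hk : 2 ≤ k)
    (hA : ∀ (U : Finset R) (V : Finset S), (∀ r ∈ U, ∀ s ∈ V, A r s = true) →
      U.card < k ∨ V.card < k)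
    (C : Circuit ι κ) (hC : C.Computes ℕ M) :
    (B.map fun b => if b then (1 : ℚ) else 0).rank *
      (Finset.univ.filter fun p : R × S => A p.1 p.2 = true ∧
        k ≤ (Finset.univ.filter fun s => A p.1 s = true).card).card ≤ C.size * (k * k) := by
  classical
  -- `val v q` is the coefficient of the input `g q` at the vertex `v`, and `U v` the set of columns
  -- of `A` on which `v` depends.
  set val : κ ⊕ C.Gate → J × S → ℕ := fun v q =>
    Sum.elim (Pi.single (g q) 1) (C.eval (Pi.single (g q) 1)) v with hval
  set U : κ ⊕ C.Gate → Finset S := fun v => Finset.univ.filter fun s => ∃ j, val v (j, s) ≠ 0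
    with hU
  have hin : ∀ j, (U (Sum.inl j)).card < k := by
    intro j
    refine lt_of_le_of_lt (Finset.card_le_one.mpr fun s hs s' hs' => ?_) hk
    have aux : ∀ s ∈ U (Sum.inl j), ∃ j', g (j', s) = j := by
      intro s hs
      obtain ⟨j', hj'⟩ := (Finset.mem_filter.mp hs).2
      refine ⟨j', ?_⟩
      by_contra hne
      exact hj' (Pi.single_eq_of_ne (Ne.symm hne) _)
    obtain ⟨j₁, h₁⟩ := aux s hs
    obtain ⟨j₂, h₂⟩ := aux s' hs'
    exact congrArg Prod.snd (hg (h₁.trans h₂.symm))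
  have hout : ∀ i r j s, C.eval (Pi.single (g (j, s)) 1) (C.out (f (i, r))) =
      if B i j = true ∧ A r s = true then 1 else 0 := by
    intro i r j s
    rw [hC, Matrix.mulVec_single_one]
    simp [hM, boolKronecker]
  have hUout : ∀ i r, U (Sum.inr (C.out (f (i, r)))) =
      Finset.univ.filter fun s => A r s = true := by
    intro i r
    ext s
    obtain ⟨j, hj⟩ := hB i
    simp only [hU, hval, Sum.elim_inr, hout, Finset.mem_filter, Finset.mem_univ, true_and]
    constructor
    · rintro ⟨j', hj'⟩
      by_contra hs
      exact hj' (if_neg fun h => hs h.2)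
    · intro hs
      exact ⟨j, by simp [hj, hs]⟩
  have hcut : ∀ i r, k ≤ (Finset.univ.filter fun s => A r s = true).card → _ := fun i r hr =>
    C.exists_cut (fun v => (U v).card < k) hin (C.out (f (i, r)))
      (by rw [hUout]; exact not_lt.mpr hr)
  choose c hc hsum using hcut
  set V : (κ ⊕ C.Gate) × C.Gate → Finset R := fun e =>
    Finset.univ.filter fun r => ∃ i hr, c i r hr e ≠ 0 with hV
  have hrect : ∀ e, (V e ×ˢ U e.1).card ≤ k * k := by
    intro e
    obtain hVe | ⟨r₀, hr₀⟩ := (V e).eq_empty_or_nonempty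
    · simp [hVe]
    · obtain ⟨i₀, hr, hne⟩ := (Finset.mem_filter.mp hr₀).2
      obtain ⟨hsmall, hbig, -⟩ := hc i₀ r₀ hr e hne
      have hVk : (V e).card < k := by
        -- The head of `e` is bounded by every output that uses `e`, so `V e` times the columns of
        -- the head is all ones in `A`. The head has at least `k` columns, which forces `V e` to be
        -- short.
        refine (hA (V e) (U (Sum.inr e.2)) fun r hr s hs => ?_).resolve_right hbig
        obtain ⟨i, hr', hne'⟩ := (Finset.mem_filter.mp hr).2
        obtain ⟨j, hj⟩ := (Finset.mem_filter.mp hs).2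
        have hle := (hc i r hr' e hne').2.2 (Pi.single (g (j, s)) 1)
        rw [hout] at hle
        by_contra hA'
        rw [if_neg fun h => hA' h.2] at hle
        exact hj (Nat.le_zero.mp hle)
      rw [Finset.card_product]
      exact Nat.mul_le_mul hVk.le (le_of_lt hsmall)
  set H := Finset.univ.filter fun p : R × S => A p.1 p.2 = true ∧
    k ≤ (Finset.univ.filter fun s => A p.1 s = true).card with hH
  have hrank : ∀ p ∈ H, (B.map fun b => if b then (1 : ℚ) else 0).rank ≤
      (C.wires.filter fun e => p.1 ∈ V e ∧ p.2 ∈ U e.1).card := by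
    rintro ⟨r, s⟩ hp
    obtain ⟨hone, hr⟩ := (Finset.mem_filter.mp hp).2
    dsimp only at hone hr ⊢
    set E := C.wires.filter fun e => r ∈ V e ∧ s ∈ U e.1 with hE
    -- For fixed `(r, s)` with `A r s = 1`, the outputs `(i, r)` on the inputs `(j, s)` spell out
    -- `B`; the cut writes them as a product with inner index a wire in `E`.
    have hfac : (B.map fun b => if b then (1 : ℚ) else 0) =
        (Matrix.of fun (i : I) (e : E) => (c i r hr e : ℚ)) *
          (Matrix.of fun (e : E) (j : J) => (val e.1.1 (j, s) : ℚ)) := by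
      ext i j
      rw [Matrix.mul_apply]
      simp only [Matrix.of_apply]
      rw [Finset.sum_coe_sort E fun e => (c i r hr e : ℚ) * (val e.1 (j, s) : ℚ)]
      have h1 := hsum i r hr (Pi.single (g (j, s)) 1)
      rw [hout] at h1
      have h2 : ∑ e ∈ E, c i r hr e * val e.1 (j, s) = if B i j = true then 1 else 0 := by
        rw [Finset.sum_subset (Finset.filter_subset _ _)]
        · simpa [hone] using h1.symm
        · intro e he heE
          by_contra hne
          obtain ⟨hne₁, hne₂⟩ := mul_ne_zero_iff.mp hne
          exact heE (Finset.mem_filter.mpr ⟨he,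
            Finset.mem_filter.mpr ⟨Finset.mem_univ _, i, hr, hne₁⟩,
            Finset.mem_filter.mpr ⟨Finset.mem_univ _, j, hne₂⟩⟩)
      rw [Matrix.map_apply]
      exact_mod_cast h2.symm
    rw [hfac]
    refine (Matrix.rank_mul_le_left _ _).trans ((Matrix.rank_le_card_width _).trans ?_)
    simp
  -- Double count the incidences between ones of `A` in heavy rows and wires.
  rw [mul_comm, ← smul_eq_mul]
  refine (Finset.card_nsmul_le_sum H _ _ hrank).trans ?_
  refine (Finset.sum_card_bipartiteAbove_eq_sum_card_bipartiteBelow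
    (s := H) (t := C.wires) fun p e => p.1 ∈ V e ∧ p.2 ∈ U e.1).le.trans ?_
  refine Finset.sum_le_card_nsmul _ _ _ fun e _ => ?_
  refine (Finset.card_le_card fun p hp => ?_).trans (hrect e)
  exact Finset.mem_product.mpr (Finset.mem_filter.mp hp).2

/-- A kernel vector has every coordinate equal to the coordinate sum `t`, so `t = n * t` and `t =
0`. -/
theorem rank_complId {n : ℕ} (hn : 2 ≤ n) :
    ((complId n).map fun b => if b then (1 : ℚ) else 0).rank = n := by
  refine (Matrix.rank_of_isUnit _ (Matrix.mulVec_injective_iff_isUnit.mp ?_)).trans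
    (Fintype.card_fin n)
  refine (injective_iff_map_eq_zero
    ((complId n).map fun b => if b then (1 : ℚ) else 0).mulVecLin).mpr fun x hx => ?_
  have h : ∀ i, (∑ j, x j) - x i = 0 := by
    intro i
    have hi := congrFun hx i
    simp only [Matrix.mulVecLin_apply, Matrix.mulVec, dotProduct, Matrix.map_apply, complId,
      Matrix.of_apply, Pi.zero_apply] at hi
    rw [← hi, sub_eq_iff_eq_add, ← Finset.sum_erase_add _ _ (Finset.mem_univ i),
      ← Finset.sum_erase_add (a := i) _ _ (Finset.mem_univ i)]
    congr 1
    simp only [ne_eq, not_true_eq_false, decide_false, Bool.false_eq_true, if_false, zero_mul,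
      add_zero]
    refine Finset.sum_congr rfl fun j hj => ?_
    simp [(Finset.ne_of_mem_erase hj).symm]
  have hs : (∑ j, x j) = n * ∑ j, x j := by
    conv_lhs => rw [Finset.sum_congr rfl fun j _ => (sub_eq_zero.mp (h j)).symm]
    simp
  have hn' : (2 : ℚ) ≤ n := by exact_mod_cast hn
  have h0 : (∑ j, x j) = 0 := by
    have : ((n : ℚ) - 1) * ∑ j, x j = 0 := by linarith
    exact (mul_eq_zero.mp this).resolve_left (by linarith)
  funext i
  have := h i
  rw [h0] at this
  simpa using this

/-! ### Dense matrices without large all-ones submatrices, by counting. -/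

/-- A matrix without a `k × k` submatrix that is constant, when there are enough matrices. -/
theorem exists_matrix_no_constant_submatrix {n k : ℕ} (h : 2 * (n ^ k * n ^ k) < 2 ^ (k * k)) :
    ∃ A : Matrix (Fin n) (Fin n) Bool, ∀ (U V : Finset (Fin n)) (b : Bool),
      (∀ r ∈ U, ∀ s ∈ V, A r s = b) → U.card < k ∨ V.card < k := by
  classical
  set subs := Finset.powersetCard k (Finset.univ : Finset (Fin n)) with hsubs
  set bad : (Finset (Fin n) × Finset (Fin n)) × Bool → Finset (Fin n × Fin n → Bool) := fun t =>
    Fintype.piFinset fun p => if p ∈ t.1.1 ×ˢ t.1.2 then {t.2} else Finset.univ with hbad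
  -- Fixing `k * k` entries leaves a fraction `2 ^ (-k²)` of all matrices; there are at most `2 * (n
  -- ^ k * n ^ k)` choices of position and constant.
  have hcard : ∀ t ∈ (subs ×ˢ subs) ×ˢ (Finset.univ : Finset Bool),
      (bad t).card * 2 ^ (k * k) = 2 ^ (n * n) := by
    rintro ⟨⟨U, V⟩, b⟩ ht
    obtain ⟨hU, hV⟩ : U.card = k ∧ V.card = k := by
      simpa [hsubs, Finset.mem_powersetCard] using ht
    have h1 : (bad ((U, V), b)).card = ∏ p : Fin n × Fin n, if p ∈ U ×ˢ V then 1 else 2 := by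
      rw [hbad, Fintype.card_piFinset]
      refine Finset.prod_congr rfl fun p _ => ?_
      dsimp only
      split_ifs <;> simp
    have h2 : 2 ^ (k * k) = ∏ p : Fin n × Fin n, if p ∈ U ×ˢ V then 2 else 1 := by
      rw [Finset.prod_ite_mem, Finset.univ_inter, Finset.prod_const, Finset.card_product, hU, hV]
    rw [h1, h2, ← Finset.prod_mul_distrib]
    rw [Finset.prod_congr rfl fun p _ => show _ = 2 by split_ifs <;> rfl]
    simp
  have hP : subs.card ≤ n ^ k := by
    rw [hsubs, Finset.card_powersetCard, Finset.card_univ, Fintype.card_fin]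
    exact Nat.choose_le_pow n k
  have hlt : (((subs ×ˢ subs) ×ˢ (Finset.univ : Finset Bool)).biUnion bad).card <
      Fintype.card (Fin n × Fin n → Bool) := by
    refine lt_of_mul_lt_mul_right (a := 2 ^ (k * k)) ?_ (Nat.zero_le _)
    calc _ ≤ (∑ t ∈ (subs ×ˢ subs) ×ˢ (Finset.univ : Finset Bool), (bad t).card) * 2 ^ (k * k) :=
          Nat.mul_le_mul_right _ Finset.card_biUnion_le
      _ = ∑ t ∈ (subs ×ˢ subs) ×ˢ (Finset.univ : Finset Bool), 2 ^ (n * n) := by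
          rw [Finset.sum_mul]; exact Finset.sum_congr rfl hcard
      _ = 2 * (subs.card * subs.card) * 2 ^ (n * n) := by simp [mul_comm]
      _ ≤ 2 * (n ^ k * n ^ k) * 2 ^ (n * n) := by gcongr
      _ < 2 ^ (k * k) * 2 ^ (n * n) := by gcongr
      _ = Fintype.card (Fin n × Fin n → Bool) * 2 ^ (k * k) := by simp [mul_comm]
  obtain ⟨a, -, ha⟩ := Finset.exists_mem_notMem_of_card_lt_card
    (hlt.trans_eq Finset.card_univ.symm)
  refine ⟨Matrix.of fun r s => a (r, s), fun U V b hUV => ?_⟩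
  by_contra hcon
  push Not at hcon
  obtain ⟨U', hU', hUk⟩ := Finset.exists_subset_card_eq hcon.1
  obtain ⟨V', hV', hVk⟩ := Finset.exists_subset_card_eq hcon.2
  refine ha (Finset.mem_biUnion.mpr ⟨((U', V'), b), ?_, ?_⟩)
  · simp [hsubs, Finset.mem_powersetCard, hUk, hVk]
  · rw [hbad, Fintype.mem_piFinset]
    rintro ⟨r, s⟩
    dsimp only
    split_ifs with hp
    · obtain ⟨hr, hs⟩ := Finset.mem_product.mp hp
      exact Finset.mem_singleton.mpr (hUV r (hU' hr) s (hV' hs))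
    · exact Finset.mem_univ _

/-- A matrix with many ones but without a `k × k` submatrix of ones. -/
theorem exists_dense_matrix_no_ones_submatrix {n k : ℕ}
    (h : 2 * (n ^ k * n ^ k) < 2 ^ (k * k)) :
    ∃ A : Matrix (Fin n) (Fin n) Bool,
      n * n ≤ 2 * (Finset.univ.filter fun p : Fin n × Fin n => A p.1 p.2 = true).card ∧
      ∀ U V : Finset (Fin n), (∀ r ∈ U, ∀ s ∈ V, A r s = true) → U.card < k ∨ V.card < k := by
  obtain ⟨A, hA⟩ := exists_matrix_no_constant_submatrix h
  have hsum := Finset.card_filter_add_card_filter_not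
    (s := (Finset.univ : Finset (Fin n × Fin n))) fun p => A p.1 p.2 = true
  rw [Finset.card_univ, Fintype.card_prod, Fintype.card_fin] at hsum
  by_cases hd : n * n ≤ 2 * (Finset.univ.filter fun p : Fin n × Fin n => A p.1 p.2 = true).card
  · exact ⟨A, hd, fun U V => hA U V true⟩
  -- Excluding both constants lets the complement replace a sparse `A`.
  · refine ⟨A.map not, ?_, fun U V hUV => hA U V false fun r hr s hs => ?_⟩
    · simp only [Matrix.map_apply, Bool.not_eq_true', ← Bool.not_eq_true]
      omega
    · simpa using hUV r hr s hs

/-- Each of the `n` rows with fewer than `k` ones loses fewer than `k` of them. -/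
theorem card_filter_heavy_rows {n k : ℕ} (A : Matrix (Fin n) (Fin n) Bool) :
    (Finset.univ.filter fun p : Fin n × Fin n => A p.1 p.2 = true).card ≤
      (Finset.univ.filter fun p : Fin n × Fin n => A p.1 p.2 = true ∧
        k ≤ (Finset.univ.filter fun s => A p.1 s = true).card).card + n * k := by
  classical
  have hlight : (Finset.univ.filter fun p : Fin n × Fin n => A p.1 p.2 = true ∧
      ¬ k ≤ (Finset.univ.filter fun s => A p.1 s = true).card).card ≤ n * k := by
    have := Finset.card_le_mul_card_image_of_maps_to (f := Prod.fst) (t := Finset.univ)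
      (s := Finset.univ.filter fun p : Fin n × Fin n => A p.1 p.2 = true ∧
      ¬ k ≤ (Finset.univ.filter fun s => A p.1 s = true).card) (fun _ _ => Finset.mem_univ _) k
      (fun r _ => by
        by_cases hr : k ≤ (Finset.univ.filter fun s => A r s = true).card
        · refine (Finset.card_eq_zero.mpr (Finset.eq_empty_of_forall_notMem ?_)).le.trans
            (Nat.zero_le _)
          rintro ⟨r', s⟩ hp
          simp only [Finset.mem_filter] at hp
          obtain ⟨⟨-, -, h1⟩, rfl⟩ := hp
          exact h1 hr
        · refine le_trans ?_ (not_le.mp hr).le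
          refine Finset.card_le_card_of_injOn Prod.snd ?_ ?_
          · rintro ⟨r', s⟩ hp
            simp only [Finset.coe_filter, Finset.mem_filter, Set.mem_ofPred_eq] at hp
            obtain ⟨⟨-, h1, -⟩, rfl⟩ := hp
            simpa using h1
          · rintro ⟨r₁, s₁⟩ h₁ ⟨r₂, s₂⟩ h₂ hs
            simp only [Finset.coe_filter, Set.mem_ofPred_eq] at h₁ h₂
            exact Prod.ext (h₁.2.trans h₂.2.symm) hs)
    simpa [mul_comm] using this
  rw [← Finset.card_filter_add_card_filter_not (s := Finset.univ.filter fun p : Fin n × Fin n =>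
    A p.1 p.2 = true) fun p => k ≤ (Finset.univ.filter fun s => A p.1 s = true).card,
    Finset.filter_filter, Finset.filter_filter]
  exact Nat.add_le_add_left hlight _

/-! ### Quantitative bounds, padding and conclusion. -/

/-- For each `n ≥ 2` there is an `n × n` matrix `A` such that every matrix which contains
`Ī_n ⊗ A` has large SUM-complexity. -/
theorem exists_matrix_sumComplexity_ge {n : ℕ} (hn : 2 ≤ n) :
    ∃ A : Matrix (Fin n) (Fin n) Bool, ∀ {ι κ : Type} [Fintype ι] [Fintype κ]
      (M : Matrix ι κ Bool) (f : Fin n × Fin n → ι) (g : Fin n × Fin n → κ),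
      Function.Injective g → (∀ p q, M (f p) (g q) = boolKronecker (complId n) A p q) →
      n * (n * n) ≤ 2 * (sumComplexity M * (2 * Nat.log 2 n + 3) ^ 2) +
        2 * (n * (n * (2 * Nat.log 2 n + 3))) := by
  classical
  -- With `L = Nat.log 2 n + 1` one has `n ≤ 2 ^ L` and `k = 2 * L + 1`, so `k * k = 2 * L * k + k`
  -- exceeds the exponent `1 + 2 * L * k`.
  set k := 2 * Nat.log 2 n + 3 with hk
  have hpow : 2 * (n ^ k * n ^ k) < 2 ^ (k * k) := by
    have hlt : n ≤ 2 ^ (Nat.log 2 n + 1) := (Nat.lt_pow_succ_log_self (by norm_num) n).le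
    calc 2 * (n ^ k * n ^ k)
        ≤ 2 * ((2 ^ (Nat.log 2 n + 1)) ^ k * (2 ^ (Nat.log 2 n + 1)) ^ k) := by gcongr
      _ = 2 ^ (1 + ((Nat.log 2 n + 1) * k + (Nat.log 2 n + 1) * k)) := by
          rw [← pow_mul, ← pow_add, pow_add 2 1, pow_one]
      _ < 2 ^ (k * k) := by
          refine Nat.pow_lt_pow_right (by norm_num) ?_
          have : k * k = (Nat.log 2 n + 1) * k + (Nat.log 2 n + 1) * k + k := by
            conv_lhs => rw [show k = (Nat.log 2 n + 1) + (Nat.log 2 n + 1) + 1 by omega]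
            rw [show (Nat.log 2 n + 1) + (Nat.log 2 n + 1) + 1 = k by omega]
            conv_lhs => rw [show k * k = ((Nat.log 2 n + 1) + (Nat.log 2 n + 1) + 1) * k by
              congr 1; omega]
            ring
          omega
  obtain ⟨A, hdense, hA⟩ := exists_dense_matrix_no_ones_submatrix hpow
  refine ⟨A, fun {ι κ} _ _ M f g hg hM => ?_⟩
  obtain ⟨C₀, hC₀, -⟩ := exists_circuit_computes ℕ M
  obtain ⟨C, hC, hsize⟩ := Nat.sInf_mem (s := {s : ℕ | ∃ C : Circuit ι κ, C.Computes ℕ M ∧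
    C.size = s}) ⟨_, C₀, hC₀, rfl⟩
  have hrow : ∀ i, ∃ j, complId n i j = true := by
    intro i
    have : Nontrivial (Fin n) := Fin.nontrivial_iff_two_le.mpr hn
    obtain ⟨j, hj⟩ := exists_ne i
    exact ⟨j, by simp [complId, hj.symm]⟩
  have hmain := rank_mul_card_le_size_mul (complId n) A M f g hg hM hrow k (by omega) hA C hC
  rw [rank_complId hn, hsize] at hmain
  change _ ≤ sumComplexity M * (k * k) at hmain
  have hheavy := card_filter_heavy_rows (k := k) A
  have h1 := Nat.mul_le_mul_left n (hdense.trans (Nat.mul_le_mul_left 2 hheavy))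
  rw [pow_two]
  linarith

theorem orComplexity_pos {ι κ : Type} [Fintype ι] [Fintype κ] (M : Matrix ι κ Bool) {i : ι}
    {j : κ} (h : M i j = true) : 0 < orComplexity M := by
  classical
  obtain ⟨C₀, hC₀, -⟩ := exists_circuit_computes BoolSemiring M
  obtain ⟨C, hC, hsize⟩ := Nat.sInf_mem (s := {s : ℕ | ∃ C : Circuit ι κ,
    C.Computes BoolSemiring M ∧ C.size = s}) ⟨_, C₀, hC₀, rfl⟩
  refine Nat.pos_of_ne_zero fun h0 => ?_
  have hw : C.wires = ∅ := Finset.card_eq_zero.mp (hsize.trans h0)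
  have h1 := hC (Pi.single j 1) i
  rw [C.eval_eq, Circuit.inWires, hw, Finset.filter_empty, Finset.sum_empty,
    Matrix.mulVec_single_one] at h1
  simp only [Matrix.col_apply, Matrix.map_apply, h, if_true] at h1
  exact BoolSemiring.zero_ne_one h1

theorem eight_mul_add_le_two_pow {l : ℕ} (hl : 6 ≤ l) : 8 * l + 12 ≤ 2 ^ l := by
  induction l, hl using Nat.le_induction with
  | base => norm_num
  | succ l hl ih => rw [pow_succ]; omega

theorem pow_three_div_logb_sq_le {n W : ℕ} (hn : 64 ≤ n)
    (h : n * (n * n) ≤ 2 * (W * (2 * Nat.log 2 n + 3) ^ 2) +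
      2 * (n * (n * (2 * Nat.log 2 n + 3)))) :
    (n : ℝ) ^ 3 / (100 * Real.logb 2 n ^ 2) ≤ W := by
  have hl : 6 ≤ Nat.log 2 n := Nat.le_log_of_pow_le (by norm_num) (by simpa using hn)
  -- This makes the loss from light rows at most half of `n³`; then `2 * Nat.log 2 n + 3 ≤ 5 * logb
  -- 2 n` yields `100 = 4 * 25`.
  have hk : 4 * (2 * Nat.log 2 n + 3) ≤ n := by
    have h1 := eight_mul_add_le_two_pow hl
    have h2 := Nat.pow_log_le_self 2 (show n ≠ 0 by omega)
    omega
  have hlog : (Nat.log 2 n : ℝ) ≤ Real.logb 2 n := by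
    simpa using Real.natLog_le_logb n 2
  have hl' : (6 : ℝ) ≤ Nat.log 2 n := by exact_mod_cast hl
  have h1 : n * (n * n) ≤ 4 * (W * (2 * Nat.log 2 n + 3) ^ 2) := by
    have := Nat.mul_le_mul_left (n * n) hk
    linarith
  have h2 : (n : ℝ) ^ 3 ≤ 4 * (W * (2 * (Nat.log 2 n : ℝ) + 3) ^ 2) := by
    have : (n : ℝ) * (n * n) ≤ 4 * (W * (2 * (Nat.log 2 n : ℝ) + 3) ^ 2) := by exact_mod_cast h1
    linarith
  have h3 : (2 * (Nat.log 2 n : ℝ) + 3) ^ 2 ≤ (5 * Real.logb 2 n) ^ 2 :=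
    pow_le_pow_left₀ (by linarith) (by linarith) 2
  have hpos : 0 < Real.logb 2 n := by linarith
  rw [div_le_iff₀ (by positivity)]
  have h4 := mul_le_mul_of_nonneg_left h3 (Nat.cast_nonneg (α := ℝ) W)
  linarith

/-- The matrix that has `B` as the submatrix indexed by the range of `e`, and zeros elsewhere. -/
noncomputable def padMatrix {α β : Type} (e : α → β) (B : Matrix α α Bool) : Matrix β β Bool :=
  open scoped Classical in
  Matrix.of fun i j => decide (∃ p q, e p = i ∧ e q = j ∧ B p q = true)

theorem padMatrix_apply {α β : Type} {e : α → β} (he : Function.Injective e)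
    (B : Matrix α α Bool) (p q : α) : padMatrix e B (e p) (e q) = B p q := by
  rw [Bool.eq_iff_iff]
  simp only [padMatrix, Matrix.of_apply, decide_eq_true_eq]
  constructor
  · rintro ⟨p', q', hp, hq, h⟩
    rwa [← he hp, ← he hq]
  · exact fun h => ⟨p, q, rfl, rfl, h⟩

theorem padMatrix_row {α β : Type} {e : α → β} (he : Function.Injective e)
    (B : Matrix α α Bool) (i : β) : {j | padMatrix e B i j = true} = ∅ ∨
      ∃ p, {j | padMatrix e B i j = true} = e '' {q | B p q = true} := by
  by_cases hi : ∃ p, e p = i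
  · obtain ⟨p, rfl⟩ := hi
    refine Or.inr ⟨p, Set.ext fun j => ?_⟩
    constructor
    · intro hj
      obtain ⟨p', q, hp, hq, h⟩ : ∃ p' q, e p' = e p ∧ e q = j ∧ B p' q = true := by
        simpa [padMatrix] using hj
      exact ⟨q, he hp ▸ h, hq⟩
    · rintro ⟨q, hq, rfl⟩
      exact (padMatrix_apply he B p q).trans hq
  · refine Or.inl (Set.eq_empty_of_forall_notMem fun j hj => hi ?_)
    obtain ⟨p, q, hp, -⟩ : ∃ p q, e p = i ∧ e q = j ∧ B p q = true := by
      simpa [padMatrix] using hj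
    exact ⟨p, hp⟩

/-- The witness is `Ī_m ⊗ A` padded by zeros. Its OR-complexity is at most `48 m² + n ≤ 52 m²`, and
`√n ≤ 2m`, whence `10400 = 2 * 52 * 100`. -/
theorem le_gapSumOr {m n : ℕ} (hm : 64 ≤ m) (hmn : m * m ≤ n) (hnm : n ≤ 4 * (m * m)) :
    1 / 10400 * ((n : ℝ) ^ (1 / 2 : ℝ) / Real.logb 2 (n : ℝ) ^ 2) ≤ gapSumOr n := by
  obtain ⟨A, hA⟩ := exists_matrix_sumComplexity_ge (show 2 ≤ m by omega)
  obtain ⟨e⟩ : Nonempty (Fin m × Fin m ↪ Fin n) :=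
    Function.Embedding.nonempty_of_card_le (by simpa using hmn)
  set M := padMatrix e (boolKronecker (complId m) A) with hM
  have happly := padMatrix_apply e.injective (boolKronecker (complId m) A)
  have hsum := pow_three_div_logb_sq_le hm (hA M e e e.injective happly)
  have hor := orComplexity_complId_kronecker_le (show 4 ≤ m by omega) A M e
    (padMatrix_row e.injective _)
  rw [Fintype.card_fin] at hor
  have hmR : (64 : ℝ) ≤ m := by exact_mod_cast hm
  have hor' : (orComplexity M : ℝ) ≤ 52 * (m : ℝ) ^ 2 := by
    have : orComplexity M ≤ 52 * m ^ 2 := by rw [pow_two] at hor ⊢; omega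
    exact_mod_cast this
  have hlogm : 0 < Real.logb 2 m := Real.logb_pos (by norm_num) (by linarith)
  have hlog : Real.logb 2 m ≤ Real.logb 2 n := by
    refine Real.logb_le_logb_of_le (by norm_num) (by linarith) ?_
    exact_mod_cast (Nat.le_mul_self m).trans hmn
  have hsumpos : (0 : ℝ) < sumComplexity M := lt_of_lt_of_le (by positivity) hsum
  -- Division by zero would make the ratio 0, so it must be excluded: the zero matrix has
  -- SUM-complexity 0, contrary to `hsumpos`.
  have horpos : (0 : ℝ) < orComplexity M := by
    have hentry : ∃ p q, boolKronecker (complId m) A p q = true := by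
      by_contra hcon
      push Not at hcon
      have hM0 : M = Matrix.of fun _ _ => false := by
        ext i j
        rw [Matrix.of_apply, ← Bool.not_eq_true]
        intro hij
        obtain ⟨p, q, -, -, h⟩ : ∃ p q, e p = i ∧ e q = j ∧
            boolKronecker (complId m) A p q = true := by simpa [hM, padMatrix] using hij
        exact hcon p q h
      have hzero : sumComplexity M ≤ 0 := by
        obtain ⟨C, hC, hsize⟩ := exists_circuit_computes ℕ M
        refine Nat.sInf_le ⟨C, hC, hsize.trans ?_⟩
        simp [hM0]
      have : sumComplexity M = 0 := Nat.le_zero.mp hzero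
      simp [this] at hsumpos
    obtain ⟨p, q, hpq⟩ := hentry
    exact_mod_cast orComplexity_pos M ((happly p q).trans hpq)
  have hsqrt : (n : ℝ) ^ (1 / 2 : ℝ) ≤ 2 * m := by
    rw [← Real.sqrt_eq_rpow]
    refine Real.sqrt_le_iff.mpr ⟨by positivity, ?_⟩
    have : (n : ℝ) ≤ 4 * (m * m) := by exact_mod_cast hnm
    linarith
  have hratio : (sumComplexity M : ℝ) / orComplexity M ≤ gapSumOr n :=
    le_ciSup (f := fun A : Matrix (Fin n) (Fin n) Bool =>
      (sumComplexity A : ℝ) / (orComplexity A : ℝ)) (Set.finite_range _).bddAbove M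
  refine le_trans ?_ hratio
  calc 1 / 10400 * ((n : ℝ) ^ (1 / 2 : ℝ) / Real.logb 2 (n : ℝ) ^ 2)
      ≤ 1 / 10400 * (2 * m / Real.logb 2 (m : ℝ) ^ 2) := by gcongr
    _ = (m : ℝ) ^ 3 / (100 * Real.logb 2 m ^ 2) / (52 * (m : ℝ) ^ 2) := by
        field_simp
        norm_num
    _ ≤ sumComplexity M / orComplexity M := by gcongr

/-- First part: `Gap_{+/∨}(n) = Ω(n^{1/2} / log² n)`. Second part: with `N = n²`, for all large
`n` there is a boolean `n × n` matrix `A` such that `Ī ⊗ A` has OR-complexity `O(N)` and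
SUM-complexity `Ω(N^{3/2} / log² N)`. -/
theorem theorem1 :
    (∃ c : ℝ, 0 < c ∧ ∃ n₀ : ℕ, ∀ n : ℕ, n₀ ≤ n →
      c * ((n : ℝ) ^ (1 / 2 : ℝ) / Real.logb 2 (n : ℝ) ^ 2) ≤ gapSumOr n) ∧
    (∃ K c : ℝ, 0 < K ∧ 0 < c ∧ ∃ n₀ : ℕ, ∀ n N : ℕ, n₀ ≤ n → N = n ^ 2 →
      ∃ A : Matrix (Fin n) (Fin n) Bool,
        (orComplexity (boolKronecker (complId n) A) : ℝ) ≤ K * (N : ℝ) ∧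
        c * ((N : ℝ) ^ (3 / 2 : ℝ) / Real.logb 2 (N : ℝ) ^ 2) ≤
          (sumComplexity (boolKronecker (complId n) A) : ℝ)) := by
  constructor
  -- `4096 = 64 ^ 2`, so that `m = Nat.sqrt n` is at least 64.
  · refine ⟨1 / 10400, by norm_num, 4096, fun n hn => ?_⟩
    have hm : 64 ≤ Nat.sqrt n := Nat.le_sqrt.mpr hn
    have hlt : n < (Nat.sqrt n + 1) * (Nat.sqrt n + 1) := Nat.lt_succ_sqrt n
    exact le_gapSumOr hm (Nat.sqrt_le n) (by nlinarith)
  -- `49 = 48 + 1` counts the `n²` output wires; `1 / 25 = 4 / 100` since `log N = 2 log n`.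
  · refine ⟨49, 1 / 25, by norm_num, by norm_num, 64, ?_⟩
    rintro n _ hn rfl
    obtain ⟨A, hA⟩ := exists_matrix_sumComplexity_ge (show 2 ≤ n by omega)
    refine ⟨A, ?_, ?_⟩
    · have hor := orComplexity_complId_kronecker_le (show 4 ≤ n by omega) A
        (boolKronecker (complId n) A) id fun p => Or.inr ⟨p, by simp⟩
      rw [Fintype.card_prod, Fintype.card_fin] at hor
      have : orComplexity (boolKronecker (complId n) A) ≤ 49 * n ^ 2 := by linarith
      exact_mod_cast this
    · have hsum := pow_three_div_logb_sq_le hn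
        (hA _ id id Function.injective_id fun _ _ => rfl)
      refine le_trans (le_of_eq ?_) hsum
      have hpow : (((n ^ 2 : ℕ) : ℝ)) ^ (3 / 2 : ℝ) = (n : ℝ) ^ 3 := by
        rw [Nat.cast_pow, ← Real.rpow_natCast, ← Real.rpow_mul (Nat.cast_nonneg n),
          ← Real.rpow_natCast]
        norm_num
      have hlog : Real.logb 2 ((n ^ 2 : ℕ) : ℝ) = 2 * Real.logb 2 n := by
        rw [Nat.cast_pow, Real.logb_pow]
        norm_num
      rw [hpow, hlog]
      have hpos : 0 < Real.logb 2 n := Real.logb_pos (by norm_num) (by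
        have : (64 : ℝ) ≤ n := by exact_mod_cast hn
        linarith)
      field_simp
      norm_num
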